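/- Let $G$ be a semisimple real Lie group that is either connected with finite center or the group of real points of a Zariski connected semisimple algebraic group over $\mathbf R$ (more generally, any real Lie group with semisimple Lie algebra, finitely many components, identity component with finite center, and each $\operatorname{Ad} g$ an inner automorphism of the complexified Lie algebra). Fix a maximal compact subgroup $K<G$ with Lie algebra $\mathfrak k$, a maximal abelian subspace $\mathfrak a$ of $\mathfrak s=\mathfrak k^\perp$ (orthogonal complement for the Killing form), and a system of positive restricted roots. Let $\mathfrak a^+\subset\mathfrak a$ be the corresponding closed positive Weyl chamber, and $\kappa:G\to\mathfrak a^+$ the Cartan projection, defined by $g\in K\exp(\kappa(g))K$. For a probability measure-preserving system $(X,m,T)$ and a measurable map $F:X\to G$ put $F_n(x)=F(T^{n-1}x)\cdots F(Tx)F(x)$. We say that $\Lambda$ is the Lyapunov spectrum of $(X,m,T)$ and $F$ if $\log\|\operatorname{Ad}F\|\in L^1(X,m)$, $\Lambda\in\mathfrak a^+$, and $\frac1n\kappa(F_n(x))\to\Lambda$ as $n\to\infty$ for $m$-a.e. $x\in X$. **Proposition.** Let $(X,m,T)$ be an ergodic probability measure-preserving system ($T$ not necessarily invertible), let $F:X\to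 G$ be measurable, and let $\Lambda\in\mathfrak a^+$ be the Lyapunov spectrum of $(X,m,T)$ and $F$. Let $Y\subset X$ be measurable with $m(Y)>0$, let $n(y)=\min\{k\ge1: T^ky\in Y\}$ be the first return time (finite for a.e. $y\in Y$), and consider the Kakutani induced system $(Y,\widetilde m,\widetilde T)$, where $\widetilde m=\frac1{m(Y)}\,m|_Y$ and $\widetilde T(y)=T^{n(y)}y$, with the map $\widetilde F:Y\to G$, $\widetilde F(y)=F_{n(y)}(y)$. Then the Lyapunov spectrum $\widetilde\Lambda$ of $(Y,\widetilde m,\widetilde T)$ and $\widetilde F$ exists (in particular $\log\|\operatorname{Ad}\widetilde F\|\in L^1(Y,\widetilde m)$), is unique, and equals $$\widetilde\Lambda=\frac1{m(Y)}\cdot\Lambda .$$ Moreover the proportionality constant is the expected return time: $n\in L^1(Y,\widetilde m)$ and $\int_Y n\,d\widetilde m=\frac1{m(Y)}$. -/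

import Mathlib

open MeasureTheory Filter Topology
open scoped Manifold TensorProduct

noncomputable section

/-! ### Lie groups: exponential map, adjoint representation -/

section LieGroups

variable (E : Type*) [NormedAddCommGroup E] [NormedSpace ℝ E]
  (G : Type*) [TopologicalSpace G] [ChartedSpace E G] [Group G]

/-- The Lie algebra of the real Lie group `G` (modelled on `E`). -/
abbrev LieAlg : Type _ := GroupLieAlgebra 𝓘(ℝ, E) G

variable {G}

/-- The exponential map: `exp x` is the value at time `1` of the integral curve through the identity
of the left-invariant vector field of `x` (this curve is the one-parameter subgroup generated by
`x`; it exists and is unique on every Lie group). -/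
def lieExp (x : LieAlg E G) : G :=
  Classical.epsilon fun g : G => ∃ γ : ℝ → G, γ 0 = 1 ∧
    IsMIntegralCurve (I := 𝓘(ℝ, E)) γ (mulInvariantVectorField x) ∧ γ 1 = g

/-- The adjoint representation: `Ad g` is the derivative at the identity of `h ↦ g * h * g⁻¹`.
The Lie algebra is, as a vector space, the model space `E`; its norm gives the operator norm of
`Ad g`. All norms being equivalent, the choice does not affect integrability of `log ‖Ad F‖`. -/
def lieAd (g : G) : E →L[ℝ] E :=
  mfderiv 𝓘(ℝ, E) 𝓘(ℝ, E) (fun h : G => g * h * g⁻¹) 1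

/-- `φ = exp A` for endomorphisms of a finite-dimensional complex vector space: the exponential
series converges to `φ` (entrywise, i.e. after pairing with vectors and linear forms). -/
def IsEndExp {V : Type*} [AddCommGroup V] [Module ℂ V] (A φ : Module.End ℂ V) : Prop :=
  ∀ (v : V) (l : Module.Dual ℂ V),
    HasSum (fun n : ℕ => ((n.factorial : ℂ))⁻¹ * l ((A ^ n) v)) (l (φ v))

/-- The group of inner automorphisms of a complex Lie algebra, generated by the `exp (ad z)`
(the inverse of `exp (ad z)` is `exp (ad (-z))`, so the submonoid generated is a group). -/
def innerAut (L : Type*) [LieRing L] [LieAlgebra ℂ L] : Submonoid (Module.End ℂ L) :=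
  Submonoid.closure {φ | ∃ z : L, IsEndExp (LieAlgebra.ad ℂ L z) φ}

variable (G) in
/-- `G` is a semisimple real Lie group of Harish-Chandra class: its Lie algebra `𝔤` is semisimple,
it has finitely many components, its identity component has finite center, and every `Ad g` is an
inner automorphism of the complexification of `𝔤`. Connected semisimple real Lie groups with finite
center, and groups of real points of Zariski connected semisimple real algebraic groups (which may
be disconnected as Lie groups) are of this kind; it is the usual setting in which the Cartan
projection is well defined. -/
structure IsSemisimpleHC [LieGroup 𝓘(ℝ, E) (minSmoothness ℝ 3) G] [CompleteSpace E] : Prop where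
  semisimple : LieAlgebra.IsSemisimple ℝ (LieAlg E G)
  finite_components : Finite (ConnectedComponents G)
  finite_center : {z : G | z ∈ connectedComponent (1 : G) ∧
    ∀ h ∈ connectedComponent (1 : G), z * h = h * z}.Finite
  inner_Ad : ∀ g : G, LinearMap.baseChange ℂ
    ((lieAd E g : E →ₗ[ℝ] E) : LieAlg E G →ₗ[ℝ] LieAlg E G) ∈ innerAut (ℂ ⊗[ℝ] LieAlg E G)

/-! ### Cartan decomposition -/

/-- The Lie algebra `𝔨` of a closed subgroup `K`. -/
def lieAlgOf (K : Subgroup G) : Set (LieAlg E G) :=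
  {x | ∀ t : ℝ, lieExp E (t • x) ∈ K}

variable [LieGroup 𝓘(ℝ, E) (minSmoothness ℝ 3) G] [CompleteSpace E]

/-- `𝔰 = 𝔨^⊥`, the orthogonal complement of `𝔨` for the Killing form. -/
def killingOrth (K : Subgroup G) : Submodule ℝ (LieAlg E G) :=
  ⨅ x ∈ lieAlgOf E K, LinearMap.ker (killingForm ℝ (LieAlg E G) x)

/-- The restricted roots `Δ ⊆ 𝔞^*`: the non-zero linear forms `α` on `𝔞` whose root space
`{y | ∀ x ∈ 𝔞, ⁅x, y⁆ = α(x) y}` is non-zero. -/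
def restrictedRoots (𝔞 : Submodule ℝ (LieAlg E G)) : Set (Module.Dual ℝ 𝔞) :=
  {α | α ≠ 0 ∧ ∃ y : LieAlg E G, y ≠ 0 ∧ ∀ x : 𝔞, ⁅(x : LieAlg E G), y⁆ = α x • y}

variable (G) in
/-- The choices entering the Cartan decomposition: a maximal compact subgroup `K`, a Cartan subspace
`𝔞` (a maximal abelian subspace of `𝔰 = 𝔨^⊥`), and a system of positive roots `Δ⁺` (a set of roots
containing exactly one of `α`, `-α` for every root `α`, and closed under those sums that are
roots). -/
structure CartanData where
  K : Subgroup G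
  maximal_compact : Maximal (fun H : Subgroup G => IsCompact (H : Set G)) K
  𝔞 : Submodule ℝ (LieAlg E G)
  maximal_abelian : Maximal (fun V : Submodule ℝ (LieAlg E G) =>
    V ≤ killingOrth E K ∧ ∀ x ∈ V, ∀ y ∈ V, ⁅x, y⁆ = 0) 𝔞
  posRoots : Set (Module.Dual ℝ 𝔞)
  posRoots_subset : posRoots ⊆ restrictedRoots E 𝔞
  pos_or_neg : ∀ α ∈ restrictedRoots E 𝔞, Xor (α ∈ posRoots) (-α ∈ posRoots)
  add_mem : ∀ α ∈ posRoots, ∀ β ∈ posRoots, α + β ∈ restrictedRoots E 𝔞 → α + β ∈ posRoots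

namespace CartanData

variable {E} (D : CartanData E G)

/-- The simple roots: the positive roots that are not the sum of two positive roots. -/
def simpleRoots : Set (Module.Dual ℝ D.𝔞) :=
  {α | α ∈ D.posRoots ∧ ¬ ∃ β ∈ D.posRoots, ∃ γ ∈ D.posRoots, α = β + γ}

/-- The positive Weyl chamber `𝔞⁺`. -/
def chamber : Set D.𝔞 := {x | ∀ α ∈ D.simpleRoots, 0 ≤ α x}

/-- The Cartan projection `κ : G → 𝔞⁺`: the unique `x ∈ 𝔞⁺` with `g ∈ K exp(x) K`. -/
def cartanProj (g : G) : D.𝔞 :=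
  Classical.epsilon fun x : D.𝔞 => x ∈ D.chamber ∧
    ∃ k₁ ∈ D.K, ∃ k₂ ∈ D.K, g = k₁ * lieExp E (x : LieAlg E G) * k₂

end CartanData

end LieGroups

/-! ### Cocycles and the Lyapunov spectrum -/

/-- The cocycle `F_n(x) = F(T^{n-1} x) ⋯ F(T x) F(x)`. -/
def cocycle {X G : Type*} [Group G] (T : X → X) (F : X → G) : ℕ → X → G
  | 0, _ => 1
  | n + 1, x => F (T^[n] x) * cocycle T F n x

/-- `Λ` is the Lyapunov spectrum of `(X, m, T)` and `F : X → G`: the map `F` is integrable, i.e.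
`log ‖Ad F‖ ∈ L¹(X, m)`, and `Λ ∈ 𝔞⁺` is the almost everywhere limit of `κ(F_n(x)) / n`. -/
structure IsLyapunovSpectrum {E : Type*} [NormedAddCommGroup E] [NormedSpace ℝ E]
    {G : Type*} [TopologicalSpace G] [ChartedSpace E G] [Group G]
    [LieGroup 𝓘(ℝ, E) (minSmoothness ℝ 3) G] [CompleteSpace E] (D : CartanData E G)
    {X : Type*} [MeasurableSpace X] (m : Measure X) (T : X → X) (F : X → G) (Λ : D.𝔞) : Prop where
  integrable : Integrable (fun x => Real.log ‖lieAd E (F x)‖) m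
  mem_chamber : Λ ∈ D.chamber
  tendsto : ∀ᵐ x ∂m,
    Tendsto (fun n : ℕ => (n : ℝ)⁻¹ • D.cartanProj (cocycle T F n x)) atTop (𝓝 Λ)

/-! ### The Kakutani induced system -/

section Induced

variable {X : Type*} (T : X → X) (Y : Set X)

/-- The first return time `n(x) = min {k ≥ 1 | T^k x ∈ Y}` (and `0` if there is no such `k`). -/
def returnTime (x : X) : ℕ := sInf {k : ℕ | 1 ≤ k ∧ T^[k] x ∈ Y}

theorem iterate_returnTime_mem (y : Y) : T^[returnTime T Y y] (y : X) ∈ Y := by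
  by_cases h : {k : ℕ | 1 ≤ k ∧ T^[k] (y : X) ∈ Y}.Nonempty
  · exact (Nat.sInf_mem h).2
  · have h0 : returnTime T Y (y : X) = 0 := by
      rw [returnTime, Set.not_nonempty_iff_eq_empty.mp h, Nat.sInf_empty]
    rw [h0]
    exact y.2

/-- The first return map `y ↦ T^{n(y)} y` on `Y`. -/
def inducedMap (y : Y) : Y := ⟨T^[returnTime T Y y] (y : X), iterate_returnTime_mem T Y y⟩

/-- The normalized restriction of `m` to `Y`, a measure on the subtype `Y`. -/
def inducedMeasure [MeasurableSpace X] (m : Measure X) : Measure Y :=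
  (m Y)⁻¹ • m.comap (Subtype.val : Y → X)

/-- The induced map `y ↦ F_{n(y)}(y)` on `Y`. -/
def inducedF {G : Type*} [Group G] (F : X → G) (y : Y) : G :=
  cocycle T F (returnTime T Y y) (y : X)

end Induced

end

/-!
The iterates of the first return map sample the original orbit: if `N_k(y)` is the time of the
`k`-th return of `y ∈ Y` to `Y`, then `F̃_k(y) = F_{N_k(y)}(y)` (`cocycle_inducedF`). An orbit that
starts in `Y` visits `Y` exactly `k` times before time `N_k(y)`, so Birkhoff's theorem for the
indicator of `Y` gives `k / N_k(y) → m(Y)`, that is `N_k(y) / k → 1 / m(Y)`. Hence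
`κ(F̃_k(y)) / k = (N_k(y) / k) · κ(F_{N_k(y)}(y)) / N_k(y)` tends to `Λ / m(Y)`. No property of the
Cartan projection enters, only the convergence along the orbits of `T`
(`Ergodic.ae_tendsto_cocycle_inducedF`). The pointwise ergodic theorem is proved here from the
maximal ergodic inequality.

Integrability rests on Kac's tower decomposition
`∫_Y ∑_{i < n(y)} f(T^i y) dm(y) = ∫ f dm` for `f ≥ 0`
(`Ergodic.setLIntegral_sum_range_returnTime`), proved without invertibility by writing `m` as a sum
of push-forwards. With `f = 1` it gives the expected return time. With `f = log ‖Ad F‖` it bounds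
the integral of `log ‖Ad F̃‖`, because `log ‖Ad ·‖` is subadditive and nonnegative. Nonnegativity is
where semisimplicity is used: `Ad g` is an inner automorphism over `ℂ`, inner automorphisms have
determinant one since `ad` is traceless on a perfect Lie algebra, and an endomorphism of determinant
one has operator norm at least one (`ContinuousLinearMap.one_le_norm_of_det_eq_one`).
-/

/-! ### The pointwise ergodic theorem -/

section PointwiseErgodic

variable {X : Type*} {T : X → X}

/-- The running maximum `max (0, S₁ f, …, Sₙ f)` of the Birkhoff sums of `f`, in its recursive
form. -/
def birkhoffMax (T : X → X) (f : X → ℝ) : ℕ → X → ℝ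
  | 0, _ => 0
  | n + 1, x => max 0 (f x + birkhoffMax T f n (T x))

theorem birkhoffMax_nonneg (f : X → ℝ) (n : ℕ) (x : X) : 0 ≤ birkhoffMax T f n x := by
  cases n with
  | zero => exact le_rfl
  | succ n => exact le_max_left _ _

theorem birkhoffMax_le_succ (f : X → ℝ) (n : ℕ) (x : X) :
    birkhoffMax T f n x ≤ birkhoffMax T f (n + 1) x := by
  induction n generalizing x with
  | zero => exact birkhoffMax_nonneg f 1 x
  | succ n ih => exact max_le_max le_rfl (by gcongr; exact ih (T x))

theorem birkhoffSum_le_birkhoffMax (f : X → ℝ) (n : ℕ) (x : X) :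
    birkhoffSum T f n x ≤ birkhoffMax T f n x := by
  induction n generalizing x with
  | zero => simp [birkhoffMax]
  | succ n ih =>
    rw [birkhoffSum_succ']
    exact (add_le_add_right (ih (T x)) (f x)).trans (le_max_right _ _)

theorem birkhoffAverage_le_of_bddAbove {f : X → ℝ} {c : ℝ} {x : X}
    (h : BddAbove (Set.range fun n => birkhoffSum T (fun x => f x - c) n x)) {ε : ℝ} (hε : 0 < ε) :
    ∀ᶠ n in atTop, birkhoffAverage ℝ T f n x ≤ c + ε := by
  obtain ⟨C, hC⟩ := h
  have h1 : Tendsto (fun n : ℕ => (n : ℝ) * ε) atTop atTop :=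
    tendsto_natCast_atTop_atTop.atTop_mul_const hε
  filter_upwards [h1.eventually_ge_atTop C, eventually_gt_atTop 0] with n hn hn0
  have hn' : (0 : ℝ) < n := by exact_mod_cast hn0
  have h2 : birkhoffSum T (fun x => f x - c) n x = birkhoffSum T f n x - n * c := by
    simp [birkhoffSum]
  have h3 : birkhoffSum T f n x - n * c ≤ C := h2 ▸ hC ⟨n, rfl⟩
  rw [birkhoffAverage, smul_eq_mul, inv_mul_le_iff₀ hn']
  linarith

variable [MeasurableSpace X] {m : Measure X}

theorem measurable_birkhoffMax (hT : Measurable T) {f : X → ℝ} (hf : Measurable f) (n : ℕ) :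
    Measurable (birkhoffMax T f n) := by
  induction n with
  | zero => exact measurable_const
  | succ n ih => exact measurable_const.max (hf.add (ih.comp hT))

theorem integrable_birkhoffMax (hT : MeasurePreserving T m m) {f : X → ℝ}
    (hf : Integrable f m) (n : ℕ) : Integrable (birkhoffMax T f n) m := by
  induction n with
  | zero => exact integrable_zero X ℝ m
  | succ n ih =>
    exact (integrable_zero X ℝ m).sup (hf.add (hT.integrable_comp_of_integrable ih))

/-- The maximal ergodic inequality: `f` has nonnegative integral over the set where one of its first
Birkhoff sums is positive. Indeed `M - M ∘ T ≤ f` on that set and `M - M ∘ T ≤ 0` off it, where `M`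
is the running maximum, and `M - M ∘ T` has integral zero. -/
theorem setIntegral_birkhoffMax_pos_nonneg (hT : MeasurePreserving T m m) {f : X → ℝ}
    (hfm : Measurable f) (hf : Integrable f m) (n : ℕ) :
    0 ≤ ∫ x in {x | 0 < birkhoffMax T f n x}, f x ∂m := by
  cases n with
  | zero => simp [birkhoffMax]
  | succ n =>
    set M := birkhoffMax T f (n + 1) with hM
    have hMm : Measurable M := measurable_birkhoffMax hT.measurable hfm _
    have hMi : Integrable M m := integrable_birkhoffMax hT hf _
    have hMT : Integrable (M ∘ T) m := hT.integrable_comp_of_integrable hMi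
    have hs : MeasurableSet {x | 0 < M x} := measurableSet_lt measurable_const hMm
    have h0 : ∫ x, (M x - (M ∘ T) x) ∂m = 0 := by
      rw [integral_sub hMi hMT, sub_eq_zero]
      have := integral_map (μ := m) hT.measurable.aemeasurable (f := M)
        (hT.map_eq.symm ▸ hMi.aestronglyMeasurable)
      rw [hT.map_eq] at this
      exact this
    rw [← integral_indicator hs]
    refine h0.symm.trans_le ?_
    refine integral_mono (hMi.sub hMT) (hf.indicator hs) fun x => ?_
    by_cases hx : 0 < M x
    · rw [Set.indicator_of_mem (by exact hx)]
      have h1 : M x = f x + birkhoffMax T f n (T x) := by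
        rcases max_choice 0 (f x + birkhoffMax T f n (T x)) with h | h
        · exact absurd hx (by rw [hM]; simp only [birkhoffMax]; rw [h]; exact lt_irrefl 0)
        · exact h
      have h2 := birkhoffMax_le_succ (T := T) f n (T x)
      simp only [Function.comp_apply]
      linarith
    · rw [Set.indicator_of_notMem (by exact hx)]
      have h1 : 0 ≤ M (T x) := birkhoffMax_nonneg f _ _
      simp only [Function.comp_apply]
      linarith

/-- If `f` has negative integral then, by the maximal ergodic inequality and ergodicity, its
Birkhoff sums are almost everywhere bounded above. -/
theorem Ergodic.ae_bddAbove_birkhoffSum (hT : Ergodic T m) {f : X → ℝ}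
    (hfm : Measurable f) (hf : Integrable f m) (hneg : ∫ x, f x ∂m < 0) :
    ∀ᵐ x ∂m, BddAbove (Set.range fun n => birkhoffSum T f n x) := by
  set B : Set X := {x | BddAbove (Set.range fun n => birkhoffSum T f n x)} with hB
  have hSm : ∀ n, Measurable (birkhoffSum T f n) := fun n =>
    Finset.measurable_sum _ fun i _ => hfm.comp (hT.measurable.iterate i)
  have hBm : MeasurableSet B := measurableSet_bddAbove_range hSm
  have hBinv : T ⁻¹' B = B := by
    ext x
    simp only [Set.mem_preimage, hB, Set.mem_ofPred_eq]
    constructor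
    · rintro ⟨C, hC⟩
      refine ⟨max 0 (f x + C), ?_⟩
      rintro _ ⟨n, rfl⟩
      cases n with
      | zero => simp
      | succ n =>
        simp only [birkhoffSum_succ']
        exact le_max_of_le_right (by gcongr; exact hC ⟨n, rfl⟩)
    · rintro ⟨C, hC⟩
      refine ⟨C - f x, ?_⟩
      rintro _ ⟨n, rfl⟩
      have := hC ⟨n + 1, rfl⟩
      simp only [birkhoffSum_succ'] at this
      simp only
      linarith
  rcases hT.toPreErgodic.ae_mem_or_ae_notMem hBm hBinv with h | h
  · exact h
  exfalso
  have hmono : Monotone fun n => {x | 0 < birkhoffMax T f n x} :=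
    monotone_nat_of_le_succ fun n x hx => lt_of_lt_of_le hx (birkhoffMax_le_succ f n x)
  have hlim := tendsto_setIntegral_of_monotone (μ := m) (f := f)
    (fun n => measurableSet_lt measurable_const (measurable_birkhoffMax hT.measurable hfm n))
    hmono hf.integrableOn
  have hge := ge_of_tendsto' hlim fun n =>
    setIntegral_birkhoffMax_pos_nonneg hT.toMeasurePreserving hfm hf n
  have hfull : (⋃ n, {x | 0 < birkhoffMax T f n x}) =ᵐ[m] Set.univ := by
    rw [eventuallyEq_univ]
    filter_upwards [h] with x hx
    by_contra hx'
    refine hx ⟨0, ?_⟩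
    rintro _ ⟨n, rfl⟩
    simp only [Set.mem_iUnion, Set.mem_ofPred_eq, not_exists, not_lt] at hx'
    exact (birkhoffSum_le_birkhoffMax f n x).trans (hx' n)
  rw [setIntegral_congr_set hfull, setIntegral_univ] at hge
  linarith

/-- One half of the pointwise ergodic theorem. -/
theorem Ergodic.ae_eventually_birkhoffAverage_le [IsProbabilityMeasure m] (hT : Ergodic T m)
    {f : X → ℝ} (hfm : Measurable f) (hf : Integrable f m) :
    ∀ᵐ x ∂m, ∀ ε : ℝ, 0 < ε →
      ∀ᶠ n in atTop, birkhoffAverage ℝ T f n x ≤ ∫ x, f x ∂m + ε := by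
  have key : ∀ k : ℕ, ∀ᵐ x ∂m, BddAbove (Set.range fun n =>
      birkhoffSum T (fun x => f x - (∫ x, f x ∂m + 1 / ((k : ℝ) + 1))) n x) := fun k => by
    refine hT.ae_bddAbove_birkhoffSum (hfm.sub_const _) (hf.sub (integrable_const _)) ?_
    rw [integral_sub hf (integrable_const _)]
    simp only [integral_const, probReal_univ, one_smul]
    have : (0 : ℝ) < 1 / ((k : ℝ) + 1) := Nat.one_div_pos_of_nat
    linarith
  filter_upwards [ae_all_iff.2 key] with x hx ε hε
  obtain ⟨k, hk⟩ := exists_nat_one_div_lt (half_pos hε)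
  filter_upwards [birkhoffAverage_le_of_bddAbove (hx k) (half_pos hε)] with n hn
  linarith

/-- Birkhoff's pointwise ergodic theorem for an ergodic probability measure. -/
theorem Ergodic.ae_tendsto_birkhoffAverage [IsProbabilityMeasure m] (hT : Ergodic T m)
    {f : X → ℝ} (hfm : Measurable f) (hf : Integrable f m) :
    ∀ᵐ x ∂m, Tendsto (fun n => birkhoffAverage ℝ T f n x) atTop (𝓝 (∫ x, f x ∂m)) := by
  filter_upwards [hT.ae_eventually_birkhoffAverage_le hfm hf,
    hT.ae_eventually_birkhoffAverage_le hfm.neg hf.neg] with x hx hx'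
  rw [Metric.tendsto_nhds]
  intro ε hε
  filter_upwards [hx (ε / 2) (half_pos hε), hx' (ε / 2) (half_pos hε)] with n h1 h2
  simp only [birkhoffAverage_neg, Pi.neg_apply, integral_neg] at h2
  rw [Real.dist_eq, abs_lt]
  constructor <;> linarith

end PointwiseErgodic

/-! ### Return times and Kac's formula -/

section ReturnTime

variable {X : Type*} {T : X → X} {Y : Set X} {x : X}

theorem returnTime_eq_zero_iff : returnTime T Y x = 0 ↔ ∀ j, T^[j + 1] x ∉ Y := by
  rw [returnTime, Nat.sInf_eq_zero]
  constructor
  · rintro (h | h) j hj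
    · exact absurd h.1 (by simp)
    · exact (h ▸ (⟨by lia, hj⟩ : j + 1 ∈ {k : ℕ | 1 ≤ k ∧ T^[k] x ∈ Y}) : j + 1 ∈ (∅ : Set ℕ))
  · refine fun h => Or.inr (Set.eq_empty_of_forall_notMem fun k hk => ?_)
    obtain ⟨j, rfl⟩ := Nat.exists_eq_succ_of_ne_zero (Nat.one_le_iff_ne_zero.1 hk.1)
    exact h j hk.2

theorem returnTime_pos_iff : 0 < returnTime T Y x ↔ ∃ j, T^[j + 1] x ∈ Y := by
  rw [Nat.pos_iff_ne_zero, Ne, returnTime_eq_zero_iff]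
  push Not
  rfl

theorem iterate_notMem_of_lt_returnTime {j : ℕ} (hj : j + 1 < returnTime T Y x) :
    T^[j + 1] x ∉ Y :=
  fun h => Nat.notMem_of_lt_sInf hj ⟨by lia, h⟩

theorem lt_returnTime_iff (h : 0 < returnTime T Y x) {i : ℕ} :
    i < returnTime T Y x ↔ ∀ j < i, T^[j + 1] x ∉ Y := by
  constructor
  · exact fun hi j hj => iterate_notMem_of_lt_returnTime (by lia)
  · intro hi
    by_contra! hlt
    obtain ⟨j, hj⟩ := Nat.exists_eq_succ_of_ne_zero h.ne'
    have hmem : returnTime T Y x ∈ {k : ℕ | 1 ≤ k ∧ T^[k] x ∈ Y} :=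
      Nat.sInf_mem (Nat.nonempty_of_pos_sInf h)
    rw [hj] at hmem hlt
    exact hi j (by lia) hmem.2

/-- The only visit to `Y` before the first return is the one at time `0`. -/
theorem birkhoffSum_indicator_returnTime (hx : x ∈ Y) (h : 0 < returnTime T Y x) :
    birkhoffSum T (Y.indicator (1 : X → ℝ)) (returnTime T Y x) x = 1 := by
  rw [birkhoffSum, Finset.sum_eq_single 0]
  · simp [hx]
  · intro i hi hi0
    obtain ⟨j, rfl⟩ := Nat.exists_eq_succ_of_ne_zero hi0
    exact Set.indicator_of_notMem
      (iterate_notMem_of_lt_returnTime (Finset.mem_range.1 hi)) _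
  · simp [h.ne']

end ReturnTime

section InducedSystem

variable {X G : Type*} [Group G] {T : X → X} {F : X → G} {Y : Set X}

theorem cocycle_add (T : X → X) (F : X → G) (a b : ℕ) (x : X) :
    cocycle T F (a + b) x = cocycle T F a (T^[b] x) * cocycle T F b x := by
  induction a with
  | zero => simp [cocycle]
  | succ a ih =>
    rw [Nat.add_right_comm, cocycle, cocycle, ih, mul_assoc, Function.iterate_add_apply]

/-- The time of the `k`-th return to `Y`: the sum of the first `k` return times along the orbit of
the first return map. -/
noncomputable def kthReturnTime (T : X → X) (Y : Set X) (k : ℕ) (y : Y) : ℕ :=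
  birkhoffSum (inducedMap T Y) (fun z : Y => returnTime T Y (z : X)) k y

theorem kthReturnTime_succ (k : ℕ) (y : Y) : kthReturnTime T Y (k + 1) y =
    kthReturnTime T Y k y + returnTime T Y (((inducedMap T Y)^[k] y : Y) : X) :=
  birkhoffSum_succ _ _ _ _

/-- The `k`-th iterate of the first return map is the original orbit at the `k`-th return time. -/
theorem coe_iterate_inducedMap (k : ℕ) (y : Y) :
    (((inducedMap T Y)^[k] y : Y) : X) = T^[kthReturnTime T Y k y] (y : X) := by
  induction k with
  | zero => simp [kthReturnTime]
  | succ k ih =>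
    rw [Function.iterate_succ_apply', kthReturnTime_succ, add_comm, Function.iterate_add_apply,
      ← ih]
    rfl

/-- The induced cocycle is the original one sampled at the return times. -/
theorem cocycle_inducedF (k : ℕ) (y : Y) :
    cocycle (inducedMap T Y) (inducedF T Y F) k y =
      cocycle T F (kthReturnTime T Y k y) (y : X) := by
  induction k with
  | zero => simp [kthReturnTime, cocycle]
  | succ k ih =>
    rw [cocycle, ih, inducedF, kthReturnTime_succ, add_comm, cocycle_add, coe_iterate_inducedMap]

theorem returnTime_iterate_inducedMap_pos {y : Y} (hy : ∃ᶠ n in atTop, T^[n] (y : X) ∈ Y) (k : ℕ) :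
    0 < returnTime T Y (((inducedMap T Y)^[k] y : Y) : X) := by
  obtain ⟨n, hn, hnY⟩ := frequently_atTop.1 hy (kthReturnTime T Y k y + 1)
  obtain ⟨j, rfl⟩ := Nat.exists_eq_add_of_le hn
  refine returnTime_pos_iff.2 ⟨j, ?_⟩
  rw [coe_iterate_inducedMap, ← Function.iterate_add_apply]
  convert hnY using 2
  lia

theorem le_kthReturnTime {y : Y} (hy : ∃ᶠ n in atTop, T^[n] (y : X) ∈ Y) (k : ℕ) :
    k ≤ kthReturnTime T Y k y := by
  induction k with
  | zero => exact Nat.zero_le _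
  | succ k ih =>
    rw [kthReturnTime_succ]
    exact Nat.add_le_add ih (returnTime_iterate_inducedMap_pos hy k)

/-- An orbit starting in `Y` visits `Y` exactly `k` times before its `k`-th return. -/
theorem birkhoffSum_indicator_kthReturnTime {y : Y} (hy : ∃ᶠ n in atTop, T^[n] (y : X) ∈ Y)
    (k : ℕ) : birkhoffSum T (Y.indicator (1 : X → ℝ)) (kthReturnTime T Y k y) (y : X) = k := by
  induction k with
  | zero => simp [kthReturnTime]
  | succ k ih =>
    rw [kthReturnTime_succ, birkhoffSum_add, ih, ← coe_iterate_inducedMap,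
      birkhoffSum_indicator_returnTime (Subtype.coe_prop _)
        (returnTime_iterate_inducedMap_pos hy k), Nat.cast_succ]

/-- If the visits to `Y` have frequency `c`, then the `k`-th return takes place at a time asymptotic
to `k / c`. -/
theorem tendsto_kthReturnTime_div {y : Y} (hy : ∃ᶠ n in atTop, T^[n] (y : X) ∈ Y) {c : ℝ}
    (hc : c ≠ 0)
    (h : Tendsto (fun n => birkhoffAverage ℝ T (Y.indicator 1) n (y : X)) atTop (𝓝 c)) :
    Tendsto (fun k : ℕ => (k : ℝ)⁻¹ * kthReturnTime T Y k y) atTop (𝓝 (1 / c)) := by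
  have hN : Tendsto (fun k => kthReturnTime T Y k y) atTop atTop :=
    tendsto_atTop_mono (le_kthReturnTime hy) tendsto_id
  rw [one_div]
  refine ((h.comp hN).inv₀ hc).congr fun k => ?_
  simp only [Function.comp_apply, birkhoffAverage, birkhoffSum_indicator_kthReturnTime hy,
    smul_eq_mul, mul_inv, inv_inv, mul_comm]

/-- Sampling a sequence of growth rate `v` at the return times yields the growth rate `v / c`. -/
theorem tendsto_comp_kthReturnTime {V : Type*} [AddCommGroup V] [Module ℝ V] [TopologicalSpace V]
    [ContinuousSMul ℝ V] {y : Y} (hy : ∃ᶠ n in atTop, T^[n] (y : X) ∈ Y) {c : ℝ}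
    (hc : c ≠ 0)
    (h : Tendsto (fun n => birkhoffAverage ℝ T (Y.indicator 1) n (y : X)) atTop (𝓝 c))
    {u : ℕ → V} {v : V} (hu : Tendsto (fun n : ℕ => (n : ℝ)⁻¹ • u n) atTop (𝓝 v)) :
    Tendsto (fun k : ℕ => (k : ℝ)⁻¹ • u (kthReturnTime T Y k y)) atTop (𝓝 ((1 / c) • v)) := by
  have hN : Tendsto (fun k => kthReturnTime T Y k y) atTop atTop :=
    tendsto_atTop_mono (le_kthReturnTime hy) tendsto_id
  refine ((tendsto_kthReturnTime_div hy hc h).smul (hu.comp hN)).congr' ?_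
  filter_upwards [eventually_gt_atTop 0] with k hk
  have : (kthReturnTime T Y k y : ℝ) ≠ 0 := by
    have := le_kthReturnTime hy k
    exact_mod_cast (by lia : kthReturnTime T Y k y ≠ 0)
  simp only [Function.comp_apply]
  rw [smul_smul, mul_assoc, mul_inv_cancel₀ this, mul_one]

end InducedSystem

section Kac

variable {X : Type*} [MeasurableSpace X] {m : Measure X} {T : X → X} {Y : Set X}

theorem measurableSet_forall_lt_iterate_notMem (hT : Measurable T) (hY : MeasurableSet Y) (i : ℕ) :
    MeasurableSet {x | ∀ j < i, T^[j + 1] x ∉ Y} := by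
  simp only [Set.ofPred_forall]
  exact .iInter fun j => .iInter fun _ => hT.iterate (j + 1) hY.compl

theorem measurableSet_forall_le_iterate_notMem (hT : Measurable T) (hY : MeasurableSet Y) (k : ℕ) :
    MeasurableSet {x | ∀ j ≤ k, T^[j] x ∉ Y} := by
  simp only [Set.ofPred_forall]
  exact .iInter fun j => .iInter fun _ => hT.iterate j hY.compl

theorem measurable_returnTime (hT : Measurable T) (hY : MeasurableSet Y) :
    Measurable (returnTime T Y) := by
  refine measurable_of_Ioi fun i => ?_
  have : returnTime T Y ⁻¹' Set.Ioi i =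
      (⋃ j, T^[j + 1] ⁻¹' Y) ∩ {x | ∀ j < i, T^[j + 1] x ∉ Y} := by
    ext x
    simp only [Set.mem_preimage, Set.mem_Ioi, Set.mem_inter_iff, Set.mem_iUnion,
      ← returnTime_pos_iff, Set.mem_ofPred_eq]
    exact ⟨fun h => ⟨Nat.zero_lt_of_lt h, (lt_returnTime_iff (Nat.zero_lt_of_lt h)).1 h⟩,
      fun h => (lt_returnTime_iff h.1).2 h.2⟩
  rw [this]
  exact (MeasurableSet.iUnion fun j => hT.iterate (j + 1) hY).inter
    (measurableSet_forall_lt_iterate_notMem hT hY i)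

/-- Under an ergodic map almost every orbit visits a set of positive measure infinitely often. -/
theorem Ergodic.ae_frequently_iterate_mem [IsProbabilityMeasure m] (hT : Ergodic T m)
    (hY : MeasurableSet Y) (hmY : 0 < m Y) : ∀ᵐ x ∂m, ∃ᶠ n in atTop, T^[n] x ∈ Y := by
  set S : Set X := {x | ∃ᶠ n in atTop, T^[n] x ∈ Y} with hSdef
  have hS : MeasurableSet S := by
    simp only [hSdef, frequently_atTop, Set.ofPred_forall, Set.ofPred_exists, Set.ofPred_and]
    exact .iInter fun a => .iUnion fun b => (MeasurableSet.const _).inter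
      (hT.measurable.iterate b hY)
  have hinv : T ⁻¹' S = S := by
    ext x
    simp only [hSdef, Set.mem_preimage, Set.mem_ofPred_eq, ← Function.iterate_succ_apply]
    conv_rhs => rw [← map_add_atTop_eq_nat 1, frequently_map]
  rcases hT.toPreErgodic.ae_mem_or_ae_notMem hS hinv with h | h
  · exact h
  · have hrec := hT.toMeasurePreserving.conservative.ae_mem_imp_frequently_image_mem
      hY.nullMeasurableSet
    refine absurd ?_ hmY.ne'
    rw [measure_eq_zero_iff_ae_notMem]
    filter_upwards [h, hrec] with x hx hx' hxY
    exact hx (hx' hxY)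

theorem Ergodic.ae_returnTime_pos [IsProbabilityMeasure m] (hT : Ergodic T m)
    (hY : MeasurableSet Y) (hmY : 0 < m Y) : ∀ᵐ x ∂m, 0 < returnTime T Y x := by
  filter_upwards [hT.ae_frequently_iterate_mem hY hmY] with x hx
  obtain ⟨n, hn, hnY⟩ := frequently_atTop.1 hx 1
  obtain ⟨j, rfl⟩ := Nat.exists_eq_succ_of_ne_zero (Nat.one_le_iff_ne_zero.1 hn)
  exact returnTime_pos_iff.2 ⟨j, hnY⟩

/-- By invariance `m S = m (T⁻¹ S)`. Pulling `S` back `k` times, and splitting off at each step the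
part that lies in `Y`, decomposes the mass of `S` by the time elapsed since the last visit to `Y`,
up to the points that have not visited `Y` at the times `0, …, k`. -/
theorem MeasureTheory.MeasurePreserving.measure_eq_sum_excursion
    (hT : MeasurePreserving T m m) (hY : MeasurableSet Y) {S : Set X} (hS : MeasurableSet S)
    (k : ℕ) :
    m S = ∑ i ∈ Finset.range (k + 1), m ({x | x ∈ Y ∧ ∀ j < i, T^[j + 1] x ∉ Y} ∩ T^[i] ⁻¹' S) +
      m ({x | ∀ j ≤ k, T^[j] x ∉ Y} ∩ T^[k] ⁻¹' S) := by
  induction k with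
  | zero =>
    rw [← measure_inter_add_sdiff S hY, Set.inter_comm S Y, Set.sdiff_eq, Set.inter_comm S]
    simp [Set.compl_def]
  | succ k ih =>
    have hE : MeasurableSet ({x | ∀ j ≤ k, T^[j] x ∉ Y} ∩ T^[k] ⁻¹' S) :=
      (measurableSet_forall_le_iterate_notMem hT.measurable hY k).inter (hT.measurable.iterate k hS)
    rw [ih, Finset.sum_range_succ _ (k + 1), add_assoc]
    congr 1
    rw [← hT.measure_preimage hE.nullMeasurableSet, ← measure_inter_add_sdiff _ hY]
    congr 2
    · ext x
      simp only [Set.mem_inter_iff, Set.mem_preimage, Set.mem_ofPred_eq, Nat.lt_succ_iff,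
        ← Function.iterate_succ_apply]
      tauto
    · ext x
      simp only [Set.mem_sdiff, Set.mem_inter_iff, Set.mem_preimage, Set.mem_ofPred_eq,
        ← Function.iterate_succ_apply]
      constructor
      · rintro ⟨⟨h1, h2⟩, h3⟩
        refine ⟨fun j hj => ?_, h2⟩
        cases j with
        | zero => exact h3
        | succ j => exact h1 j (by lia)
      · exact fun ⟨h1, h2⟩ => ⟨⟨fun j hj => h1 (j + 1) (by lia), h2⟩, h1 0 (by lia)⟩

/-- The measure `m` is the sum of the push-forwards of its restrictions to the sets of points of
`Y` that do not return to `Y` at the times `1, …, i`. This is Kac's tower decomposition; in terms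
of measures it also holds for non-invertible maps, whose towers need not have disjoint levels. -/
theorem Ergodic.eq_sum_map_restrict_excursion [IsProbabilityMeasure m] (hT : Ergodic T m)
    (hY : MeasurableSet Y) (hmY : 0 < m Y) :
    m = Measure.sum fun i =>
      (m.restrict {x | x ∈ Y ∧ ∀ j < i, T^[j + 1] x ∉ Y}).map T^[i] := by
  ext S hS
  rw [Measure.sum_apply _ hS]
  have hterm : ∀ i, (m.restrict {x | x ∈ Y ∧ ∀ j < i, T^[j + 1] x ∉ Y}).map T^[i] S =
      m ({x | x ∈ Y ∧ ∀ j < i, T^[j + 1] x ∉ Y} ∩ T^[i] ⁻¹' S) := fun i => by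
    rw [Measure.map_apply (hT.measurable.iterate i) hS,
      Measure.restrict_apply (hT.measurable.iterate i hS), Set.inter_comm]
  simp only [hterm]
  have hdec := fun k => hT.toMeasurePreserving.measure_eq_sum_excursion hY hS k
  apply le_antisymm
  · have hlim : Tendsto (fun k => m {x | ∀ j ≤ k, T^[j] x ∉ Y}) atTop (𝓝 0) := by
      have h0 : m (⋂ k, {x | ∀ j ≤ k, T^[j] x ∉ Y}) = 0 := by
        rw [measure_eq_zero_iff_ae_notMem]
        filter_upwards [hT.ae_frequently_iterate_mem hY hmY] with x hx hx'
        obtain ⟨n, hn⟩ := hx.exists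
        exact Set.mem_iInter.1 hx' n n le_rfl hn
      rw [← h0]
      exact tendsto_measure_iInter_atTop
        (fun k => (measurableSet_forall_le_iterate_notMem hT.measurable hY k).nullMeasurableSet)
        (fun k l hkl x hx j hj => hx j (hj.trans hkl)) ⟨0, measure_ne_top m _⟩
    have hlim' := hlim.const_add
      (∑' i, m ({x | x ∈ Y ∧ ∀ j < i, T^[j + 1] x ∉ Y} ∩ T^[i] ⁻¹' S))
    rw [add_zero] at hlim'
    refine ge_of_tendsto' hlim' fun k => ?_
    rw [hdec k]
    exact add_le_add (ENNReal.sum_le_tsum _) (measure_mono Set.inter_subset_left)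
  · refine ENNReal.tsum_le_of_sum_range_le fun k => ?_
    refine le_trans ?_ (le_of_le_of_eq le_self_add (hdec k).symm)
    exact Finset.sum_le_sum_of_subset (Finset.range_mono k.le_succ)

/-- Kac's formula in integrated form: summing `f` along the excursions from `Y` integrates to the
integral of `f` over the whole space. -/
theorem Ergodic.setLIntegral_sum_range_returnTime [IsProbabilityMeasure m] (hT : Ergodic T m)
    (hY : MeasurableSet Y) (hmY : 0 < m Y) {f : X → ENNReal} (hf : Measurable f) :
    ∫⁻ y in Y, ∑ i ∈ Finset.range (returnTime T Y y), f (T^[i] y) ∂m = ∫⁻ x, f x ∂m := by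
  have hA : ∀ i, MeasurableSet {x | x ∈ Y ∧ ∀ j < i, T^[j + 1] x ∉ Y} := fun i =>
    hY.inter (measurableSet_forall_lt_iterate_notMem hT.measurable hY i)
  have hfi : ∀ i, Measurable fun x => f (T^[i] x) := fun i => hf.comp (hT.measurable.iterate i)
  conv_rhs => rw [hT.eq_sum_map_restrict_excursion hY hmY, lintegral_sum_measure]
  have hterm : ∀ i,
      ∫⁻ x, f x ∂(m.restrict {x | x ∈ Y ∧ ∀ j < i, T^[j + 1] x ∉ Y}).map T^[i] =
        ∫⁻ x, {x | x ∈ Y ∧ ∀ j < i, T^[j + 1] x ∉ Y}.indicator (fun x => f (T^[i] x)) x ∂m :=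
    fun i => by rw [lintegral_map hf (hT.measurable.iterate i), lintegral_indicator (hA i)]
  simp only [hterm]
  rw [← lintegral_tsum fun i => ((hfi i).indicator (hA i)).aemeasurable, ← lintegral_indicator hY]
  refine lintegral_congr_ae ?_
  filter_upwards [hT.ae_returnTime_pos hY hmY] with x hx
  by_cases hxY : x ∈ Y
  · rw [Set.indicator_of_mem hxY, tsum_eq_sum (s := Finset.range (returnTime T Y x))]
    · refine Finset.sum_congr rfl fun i hi => ?_
      rw [Set.indicator_of_mem]
      exact ⟨hxY, (lt_returnTime_iff hx).1 (Finset.mem_range.1 hi)⟩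
    · intro i hi
      refine Set.indicator_of_notMem (fun h => hi ?_) _
      exact Finset.mem_range.2 ((lt_returnTime_iff hx).2 h.2)
  · rw [Set.indicator_of_notMem hxY]
    refine (ENNReal.tsum_eq_zero.2 fun i => Set.indicator_of_notMem (fun h => hxY h.1) _).symm

end Kac

/-! ### Determinants of inner automorphisms and the adjoint representation -/

section DetExp

variable {n : Type*} [Fintype n] [DecidableEq n]

/-- The derivative of the determinant at the identity is the trace, for a curve of matrices that is
differentiable entry by entry. -/
theorem Matrix.hasDerivAt_det_of_eq_one {C : ℂ → Matrix n n ℂ} {M : Matrix n n ℂ} (h0 : C 0 = 1)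
    (hC : ∀ i j, HasDerivAt (fun t => C t i j) (M i j) 0) :
    HasDerivAt (fun t => (C t).det) M.trace 0 := by
  -- The product rule shows that the derivative depends on `C 0` and on `M` only, so that it can be
  -- computed on the curve `1 + t • M`.
  have key : ∀ C : ℂ → Matrix n n ℂ, C 0 = 1 →
      (∀ i j, HasDerivAt (fun t => C t i j) (M i j) 0) →
      HasDerivAt (fun t => (C t).det) (∑ σ : Equiv.Perm n, (Equiv.Perm.sign σ : ℂ) *
        ∑ i, (∏ j ∈ Finset.univ.erase i, (1 : Matrix n n ℂ) (σ j) j) • M (σ i) i) 0 := by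
    intro C h0 hC
    simp only [Matrix.det_apply']
    refine HasDerivAt.fun_sum fun σ _ => HasDerivAt.const_mul _ ?_
    have := HasDerivAt.fun_finsetProd (u := Finset.univ) (x := (0 : ℂ))
      (f := fun i t => C t (σ i) i) (f' := fun i => M (σ i) i) fun i _ => hC (σ i) i
    rwa [h0] at this
  have h1 := key (fun t => 1 + t • M) (by simp) fun i j => by
    simpa using ((hasDerivAt_id (0 : ℂ)).mul_const (M i j)).const_add ((1 : Matrix n n ℂ) i j)
  have h2 : HasDerivAt (fun t : ℂ => (1 + t • M).det) M.trace 0 := by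
    have h3 : ∀ p : Polynomial ℂ,
        HasDerivAt (fun t : ℂ => 1 + M.trace * t + p.eval t * t ^ 2) M.trace 0 := fun p => by
      have h4 := (((hasDerivAt_id (0 : ℂ)).const_mul M.trace).const_add 1).fun_add
        ((p.hasDerivAt 0).fun_mul (hasDerivAt_pow 2 (0 : ℂ)))
      exact h4.congr_deriv (by simp)
    exact (h3 _).congr_of_eventuallyEq (.of_forall fun t => Matrix.det_one_add_smul t M)
  rw [h2.unique h1]
  exact key C h0 hC

attribute [local instance] Matrix.linftyOpNormedRing Matrix.linftyOpNormedAlgebra in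
theorem Matrix.hasDerivAt_exp_smul_apply (M : Matrix n n ℂ) (i j : n) :
    HasDerivAt (fun t : ℂ => NormedSpace.exp (t • M) i j) (M i j) 0 := by
  have h := hasDerivAt_exp_smul_const (𝕂 := ℂ) M (0 : ℂ)
  rw [zero_smul, NormedSpace.exp_zero, one_mul] at h
  exact ((Matrix.entryLinearMap ℂ ℂ i j).toContinuousLinearMap.hasFDerivAt).comp_hasDerivAt
    (0 : ℂ) h

attribute [local instance] Matrix.linftyOpNormedRing Matrix.linftyOpNormedAlgebra in
/-- `det (exp M) = 1` for `M` of trace zero: `t ↦ det (exp (t M))` is multiplicative with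
derivative `trace M = 0` at the origin, hence constant. -/
theorem Matrix.det_exp_of_trace_eq_zero {M : Matrix n n ℂ} (hM : M.trace = 0) :
    (NormedSpace.exp M).det = 1 := by
  set g : ℂ → ℂ := fun t => (NormedSpace.exp (t • M)).det with hg
  have hg0 : HasDerivAt g 0 0 := by
    have := Matrix.hasDerivAt_det_of_eq_one (C := fun t => NormedSpace.exp (t • M)) (by simp)
      (Matrix.hasDerivAt_exp_smul_apply M)
    rwa [hM] at this
  have hmul : ∀ s t, g (s + t) = g s * g t := fun s t => by
    simp only [hg]
    rw [add_smul, Matrix.exp_add_of_commute _ _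
      (((Commute.refl M).smul_left s).smul_right t), Matrix.det_mul]
  have hd : ∀ t, HasDerivAt g 0 t := fun t => by
    have h1 : HasDerivAt (fun u => g t * g (u - t)) (g t * 0) t := by
      refine HasDerivAt.const_mul (g t) (HasDerivAt.comp_sub_const t t ?_)
      rwa [sub_self]
    rw [mul_zero] at h1
    refine h1.congr_of_eventuallyEq (.of_forall fun u => ?_)
    simp only
    rw [← hmul, add_sub_cancel]
  have h := is_const_of_deriv_eq_zero (fun t => (hd t).differentiableAt) (fun t => (hd t).deriv) 1 0
  simpa [hg] using h

attribute [local instance] Matrix.linftyOpNormedRing Matrix.linftyOpNormedAlgebra in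
/-- `det (exp A) = 1` for a traceless endomorphism `A`, computed in a basis. -/
theorem IsEndExp.det_eq_one {V : Type*} [AddCommGroup V] [Module ℂ V] [FiniteDimensional ℂ V]
    {A φ : Module.End ℂ V} (h : IsEndExp A φ) (hA : LinearMap.trace ℂ V A = 0) :
    LinearMap.det φ = 1 := by
  classical
  set b := Module.finBasis ℂ V
  rw [← LinearMap.det_toMatrix b]
  have hexp : LinearMap.toMatrix b b φ = NormedSpace.exp (LinearMap.toMatrix b b A) := by
    ext i j
    have h1 := h (b j) (b.coord i)
    have h2 := (NormedSpace.exp_series_hasSum_exp' (𝕂 := ℂ) (LinearMap.toMatrix b b A)).mapL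
      (Matrix.entryLinearMap ℂ ℂ i j).toContinuousLinearMap
    rw [LinearMap.toMatrix_apply]
    refine h1.unique (h2.congr_fun fun k => ?_)
    rw [LinearMap.toMatrix_pow]
    change _ = (k.factorial : ℂ)⁻¹ * LinearMap.toMatrix b b (A ^ k) i j
    rw [LinearMap.toMatrix_apply]
    rfl
  rw [hexp]
  exact Matrix.det_exp_of_trace_eq_zero (by rw [← LinearMap.trace_eq_matrix_trace]; exact hA)

end DetExp

section Semisimple

variable {L : Type*} [LieRing L] [LieAlgebra ℝ L]

/-- A semisimple Lie algebra is perfect, so that its adjoint representation is traceless. -/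
theorem LieAlgebra.IsSemisimple.trace_ad_eq_zero [LieAlgebra.IsSemisimple ℝ L] (x : L) :
    LinearMap.trace ℝ L (LieAlgebra.ad ℝ L x) = 0 := by
  have hlie : ∀ x y : L, LinearMap.trace ℝ L (LieAlgebra.ad ℝ L ⁅x, y⁆) = 0 := fun x y => by
    have h : LieAlgebra.ad ℝ L ⁅x, y⁆ =
        LieAlgebra.ad ℝ L x * LieAlgebra.ad ℝ L y - LieAlgebra.ad ℝ L y * LieAlgebra.ad ℝ L x := by
      ext z; simp
    rw [h, map_sub, LinearMap.trace_mul_comm, sub_self]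
  let J : LieIdeal ℝ L :=
    { LinearMap.ker (LinearMap.trace ℝ L ∘ₗ (LieAlgebra.ad ℝ L : L →ₗ[ℝ] Module.End ℝ L)) with
      lie_mem := fun {x y} _ => hlie x y }
  have hJ : ∀ x y : L, ⁅x, y⁆ ∈ J := hlie
  have htop : J = ⊤ := by
    rw [eq_top_iff, ← LieAlgebra.IsSemisimple.sSup_atoms_eq_top (R := ℝ) (L := L)]
    refine sSup_le fun I hI => ?_
    -- An atom `I` not contained in `J` would meet it trivially; as all brackets lie in `J`, it would
    -- then be abelian.
    rcases hI.le_iff.1 (inf_le_left : I ⊓ J ≤ I) with h | h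
    · refine absurd ⟨fun a b => ?_⟩ (LieAlgebra.IsSemisimple.non_abelian_of_isAtom I hI)
      have : ⁅(a : L), (b : L)⁆ ∈ I ⊓ J := ⟨lie_mem_right ℝ L I _ _ b.2, hJ _ _⟩
      rw [h] at this
      exact Subtype.ext this
    · exact inf_eq_left.1 h
  have hx : x ∈ J := by rw [htop]; exact LieSubmodule.mem_top x
  exact hx

theorem trace_ad_baseChange_eq_zero [LieAlgebra.IsSemisimple ℝ L] [FiniteDimensional ℝ L]
    (z : ℂ ⊗[ℝ] L) : LinearMap.trace ℂ (ℂ ⊗[ℝ] L) (LieAlgebra.ad ℂ (ℂ ⊗[ℝ] L) z) = 0 := by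
  induction z with
  | zero => simp
  | add x y hx hy => simp [hx, hy]
  | tmul c x =>
    have h : c ⊗ₜ[ℝ] x = c • ((1 : ℂ) ⊗ₜ[ℝ] x) := by simp [TensorProduct.smul_tmul']
    have h2 : LieAlgebra.ad ℂ (ℂ ⊗[ℝ] L) ((1 : ℂ) ⊗ₜ[ℝ] x) =
      (LieAlgebra.ad ℝ L x).baseChange ℂ := LieModule.toEnd_baseChange ℝ ℂ L L x
    rw [h, map_smul, map_smul, h2, LinearMap.trace_baseChange,
      LieAlgebra.IsSemisimple.trace_ad_eq_zero, map_zero, smul_zero]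

/-- An endomorphism whose complexification is an inner automorphism has determinant one, since each
`exp (ad z)` has. -/
theorem det_eq_one_of_baseChange_mem_innerAut [LieAlgebra.IsSemisimple ℝ L] [FiniteDimensional ℝ L]
    {f : L →ₗ[ℝ] L} (hf : f.baseChange ℂ ∈ innerAut (ℂ ⊗[ℝ] L)) : LinearMap.det f = 1 := by
  have key : ∀ φ ∈ innerAut (ℂ ⊗[ℝ] L), LinearMap.det φ = 1 := fun φ hφ => by
    refine Submonoid.closure_induction ?_ (by simp) (fun a b _ _ ha hb => by simp [ha, hb]) hφ
    rintro φ ⟨z, hz⟩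
    exact hz.det_eq_one (trace_ad_baseChange_eq_zero z)
  have h := key _ hf
  rw [LinearMap.det_baseChange] at h
  exact (algebraMap ℝ ℂ).injective (by rw [h, map_one])

end Semisimple

/-- A determinant-one endomorphism is not a contraction: otherwise its powers would tend to `0`,
which has determinant `0`. -/
theorem ContinuousLinearMap.one_le_norm_of_det_eq_one {E : Type*} [NormedAddCommGroup E]
    [NormedSpace ℝ E] [FiniteDimensional ℝ E] [Nontrivial E] {A : E →L[ℝ] E}
    (hA : LinearMap.det (A : E →ₗ[ℝ] E) = 1) : 1 ≤ ‖A‖ := by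
  by_contra! h
  have h1 := tendsto_pow_atTop_nhds_zero_of_norm_lt_one h
  have h2 := (ContinuousLinearMap.continuous_det.tendsto (0 : E →L[ℝ] E)).comp h1
  have h3 : ∀ k : ℕ, (A ^ k).det = 1 := fun k => by
    have : ((A ^ k : E →L[ℝ] E) : E →ₗ[ℝ] E) = (A : E →ₗ[ℝ] E) ^ k := by
      ext; simp
    rw [ContinuousLinearMap.det, this, map_pow, hA, one_pow]
  have h4 : (0 : E →L[ℝ] E).det = 0 := by
    rw [ContinuousLinearMap.det]
    exact LinearMap.det_zero'' 
  rw [h4] at h2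
  refine zero_ne_one (tendsto_nhds_unique h2 ?_)
  simp [Function.comp_def, h3]

section Adjoint

variable {E : Type*} [NormedAddCommGroup E] [NormedSpace ℝ E]
  {G : Type*} [TopologicalSpace G] [ChartedSpace E G] [Group G]

theorem lieAd_one : lieAd E (1 : G) = ContinuousLinearMap.id ℝ E := by
  have : (fun h : G => 1 * h * 1⁻¹) = id := by ext; simp
  rw [lieAd, this]
  exact mfderiv_id

theorem log_norm_lieAd_one_nonpos : Real.log ‖lieAd E (1 : G)‖ ≤ 0 := by
  rw [lieAd_one]
  exact Real.log_nonpos (norm_nonneg _) ContinuousLinearMap.norm_id_le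

variable [LieGroup 𝓘(ℝ, E) (minSmoothness ℝ 3) G]

theorem contMDiff_conj (g : G) :
    ContMDiff 𝓘(ℝ, E) 𝓘(ℝ, E) (minSmoothness ℝ 3) (fun h : G => g * h * g⁻¹) :=
  (contMDiff_const.mul contMDiff_id).mul contMDiff_const

theorem mdifferentiable_conj (g : G) :
    MDifferentiable 𝓘(ℝ, E) 𝓘(ℝ, E) (fun h : G => g * h * g⁻¹) :=
  (contMDiff_conj g).mdifferentiable (by simp)

theorem lieAd_mul (g h : G) : lieAd E (g * h) = (lieAd E g).comp (lieAd E h) := by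
  have hc : (fun k : G => g * h * k * (g * h)⁻¹) =
      (fun k : G => g * k * g⁻¹) ∘ fun k : G => h * k * h⁻¹ := by
    ext k; simp [mul_assoc]
  have h1 : h * 1 * h⁻¹ = 1 := by simp
  rw [lieAd, hc, mfderiv_comp_of_eq (mdifferentiable_conj g _) (mdifferentiable_conj h _) h1]
  rw [h1]
  rfl

/-- The map `h ↦ g * h * g⁻¹` fixes the identity for every `g`, so that `Ad` is read in one and the
same chart for all `g` and depends continuously on `g` as a map into `E →L[ℝ] E`. -/
theorem continuous_lieAd [CompleteSpace E] : Continuous fun g : G => lieAd E g := by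
  rw [continuous_iff_continuousAt]
  intro g₀
  have hf : ContMDiffAt (𝓘(ℝ, E).prod 𝓘(ℝ, E)) 𝓘(ℝ, E) (minSmoothness ℝ 3)
      (Function.uncurry fun g h : G => g * h * g⁻¹) (g₀, 1) :=
    ((contMDiff_fst.mul contMDiff_snd).mul contMDiff_fst.inv).contMDiffAt
  have : IsManifold 𝓘(ℝ, E) 1 G := .of_le (n := minSmoothness ℝ 3) (by simp)
  have h := ContMDiffAt.mfderiv (m := 0) (I := 𝓘(ℝ, E)) (I' := 𝓘(ℝ, E)) (n := minSmoothness ℝ 3)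
    (fun g h : G => g * h * g⁻¹) (fun _ => 1)
    hf contMDiffAt_const (by simp)
  have hself : ∀ w : E, (tangentBundleCore 𝓘(ℝ, E) G).coordChange (achart E (1 : G))
        (achart E (1 : G)) 1 w = w :=
      (tangentBundleCore 𝓘(ℝ, E) G).coordChange_self _ _ (mem_chart_source E (1 : G))
  have e : ∀ g : G, inTangentCoordinates 𝓘(ℝ, E) 𝓘(ℝ, E) (fun _ : G => (1 : G))
      (fun x => x * 1 * x⁻¹) (fun x => (lieAd E x : E →L[ℝ] E)) g₀ g = lieAd E g := by
    intro g
    have hg : ∀ g : G, g * 1 * g⁻¹ = 1 := by simp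
    rw [inTangentCoordinates_eq (I := 𝓘(ℝ, E)) (I' := 𝓘(ℝ, E)) (fun _ : G => (1 : G))
      (fun x => x * 1 * x⁻¹) _ (mem_chart_source E (1 : G))
      (by simp only [hg]; exact mem_chart_source E (1 : G))]
    simp only [hg]
    ext v
    simp only [ContinuousLinearMap.comp_apply, hself]
  have h' : ContinuousAt (inTangentCoordinates 𝓘(ℝ, E) 𝓘(ℝ, E) (fun _ : G => (1 : G))
      (fun x => x * 1 * x⁻¹) (fun x => (lieAd E x : E →L[ℝ] E)) g₀) g₀ := h.continuousAt
  exact h'.congr (.of_forall e)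

theorem measurable_log_norm_lieAd [CompleteSpace E] [MeasurableSpace G]
    [BorelSpace G] :
    Measurable fun g : G => Real.log ‖lieAd E g‖ :=
  Real.measurable_log.comp continuous_lieAd.norm.measurable

end Adjoint

/-! ### Cocycles over the induced system -/

section InducedMeasure

variable {X : Type*} [MeasurableSpace X] {m : Measure X} {Y : Set X}

theorem lintegral_inducedMeasure (hY : MeasurableSet Y) (f : X → ENNReal) :
    ∫⁻ y : Y, f y ∂(inducedMeasure Y m) = (m Y)⁻¹ * ∫⁻ y in Y, f y ∂m := by
  rw [inducedMeasure, lintegral_smul_measure, lintegral_subtype_comap hY, smul_eq_mul]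

theorem ae_inducedMeasure_of_ae (hY : MeasurableSet Y) {p : X → Prop} (h : ∀ᵐ x ∂m, p x) :
    ∀ᵐ y : Y ∂(inducedMeasure Y m), p y := by
  refine Measure.ae_smul_measure ?_ _
  exact (ae_restrict_iff_subtype hY).1 (ae_restrict_of_ae h)

theorem isProbabilityMeasure_inducedMeasure [IsFiniteMeasure m] (hY : MeasurableSet Y)
    (hmY : 0 < m Y) : IsProbabilityMeasure (inducedMeasure Y m) := by
  refine ⟨?_⟩
  have h := lintegral_inducedMeasure (m := m) hY 1
  simp only [Pi.one_apply, lintegral_one, Measure.restrict_apply_univ] at h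
  rw [h, ENNReal.inv_mul_cancel hmY.ne' (measure_ne_top m Y)]

variable [IsProbabilityMeasure m] {T : X → X}

/-- Kac's formula for the expected return time. -/
theorem Ergodic.lintegral_returnTime (hT : Ergodic T m) (hY : MeasurableSet Y) (hmY : 0 < m Y) :
    ∫⁻ y : Y, (returnTime T Y y : ENNReal) ∂(inducedMeasure Y m) = (m Y)⁻¹ := by
  have h := hT.setLIntegral_sum_range_returnTime hY hmY (f := 1) measurable_one
  simp only [Pi.one_apply, Finset.sum_const, Finset.card_range, nsmul_eq_mul, mul_one,
    lintegral_one, measure_univ] at h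
  rw [lintegral_inducedMeasure hY (fun x => (returnTime T Y x : ENNReal)), h, mul_one]

theorem Ergodic.integrable_returnTime (hT : Ergodic T m) (hY : MeasurableSet Y) (hmY : 0 < m Y) :
    Integrable (fun y : Y => (returnTime T Y y : ℝ)) (inducedMeasure Y m) := by
  have hr : Measurable fun y : Y => returnTime T Y y :=
    (measurable_returnTime hT.measurable hY).comp measurable_subtype_coe
  refine ⟨(measurable_from_nat.comp hr).aestronglyMeasurable, ?_⟩
  rw [hasFiniteIntegral_iff_ofReal (.of_forall fun y => Nat.cast_nonneg _)]
  simp only [ENNReal.ofReal_natCast]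
  rw [hT.lintegral_returnTime hY hmY]
  exact ENNReal.inv_lt_top.2 hmY

theorem Ergodic.integral_returnTime (hT : Ergodic T m) (hY : MeasurableSet Y) (hmY : 0 < m Y) :
    ∫ y : Y, (returnTime T Y y : ℝ) ∂(inducedMeasure Y m) = 1 / m.real Y := by
  rw [integral_eq_lintegral_of_nonneg_ae (.of_forall fun y => Nat.cast_nonneg _)
    (hT.integrable_returnTime hY hmY).aestronglyMeasurable]
  simp only [ENNReal.ofReal_natCast]
  rw [hT.lintegral_returnTime hY hmY, ENNReal.toReal_inv, one_div, Measure.real]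

/-- A nonnegative function on `Y` that is bounded by the sum of an integrable function over the
excursion from `Y` is integrable, by Kac's formula. -/
theorem Ergodic.integrable_inducedMeasure_of_le (hT : Ergodic T m) (hY : MeasurableSet Y)
    (hmY : 0 < m Y) {f : X → ℝ} (hfm : Measurable f) (hf : Integrable f m) (hf0 : ∀ x, 0 ≤ f x)
    {g : Y → ℝ} (hgm : Measurable g) (hg0 : ∀ y, 0 ≤ g y)
    (hgf : ∀ y : Y, g y ≤ ∑ i ∈ Finset.range (returnTime T Y y), f (T^[i] y)) :
    Integrable g (inducedMeasure Y m) := by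
  refine ⟨hgm.aestronglyMeasurable, ?_⟩
  rw [hasFiniteIntegral_iff_ofReal (.of_forall hg0)]
  have hle : ∀ y : Y, ENNReal.ofReal (g y) ≤
      ∑ i ∈ Finset.range (returnTime T Y y), ENNReal.ofReal (f (T^[i] y)) := fun y => by
    rw [← ENNReal.ofReal_sum_of_nonneg fun i _ => hf0 _]
    exact ENNReal.ofReal_le_ofReal (hgf y)
  refine (lintegral_mono hle).trans_lt ?_
  rw [lintegral_inducedMeasure hY
      fun x => ∑ i ∈ Finset.range (returnTime T Y x), ENNReal.ofReal (f (T^[i] x)),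
    hT.setLIntegral_sum_range_returnTime hY hmY hfm.ennreal_ofReal]
  refine ENNReal.mul_lt_top (ENNReal.inv_lt_top.2 hmY) ?_
  exact (hasFiniteIntegral_iff_ofReal (.of_forall hf0)).1 hf.hasFiniteIntegral

end InducedMeasure

section Cocycle

variable {X : Type*} {T : X → X} {G : Type*} [Group G] {F : X → G}

/-- A subadditive function of a cocycle is bounded by its Birkhoff sum. -/
theorem map_cocycle_le_sum {ℓ : G → ℝ} (h1 : ℓ 1 ≤ 0) (hmul : ∀ g h, ℓ (g * h) ≤ ℓ g + ℓ h)
    (n : ℕ) (x : X) : ℓ (cocycle T F n x) ≤ ∑ i ∈ Finset.range n, ℓ (F (T^[i] x)) := by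
  induction n with
  | zero => simpa [cocycle] using h1
  | succ n ih =>
    rw [cocycle, Finset.sum_range_succ, add_comm]
    exact (hmul _ _).trans (by gcongr)

variable [MeasurableSpace X] [MeasurableSpace G] [MeasurableMul₂ G]

theorem measurable_cocycle (hT : Measurable T) (hF : Measurable F) (n : ℕ) :
    Measurable (cocycle T F n) := by
  induction n with
  | zero => exact measurable_const
  | succ n ih => exact (hF.comp (hT.iterate n)).mul ih

theorem measurable_inducedF {Y : Set X} (hT : Measurable T) (hF : Measurable F)
    (hY : MeasurableSet Y) : Measurable (inducedF T Y F) := by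
  have h : Measurable fun p : ℕ × X => cocycle T F p.1 p.2 :=
    measurable_from_prod_countable_right fun n => measurable_cocycle hT hF n
  exact h.comp (((measurable_returnTime hT hY).comp measurable_subtype_coe).prodMk
    measurable_subtype_coe)

end Cocycle

section LogNormAd

variable {E : Type*} [NormedAddCommGroup E] [NormedSpace ℝ E] [FiniteDimensional ℝ E]
  [CompleteSpace E] {G : Type*} [TopologicalSpace G] [ChartedSpace E G] [Group G]
  [LieGroup 𝓘(ℝ, E) (minSmoothness ℝ 3) G]

theorem IsSemisimpleHC.det_lieAd (hG : IsSemisimpleHC E G) (g : G) :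
    LinearMap.det (lieAd E g : E →ₗ[ℝ] E) = 1 := by
  have := hG.semisimple
  have : FiniteDimensional ℝ (LieAlg E G) := inferInstanceAs (FiniteDimensional ℝ E)
  exact det_eq_one_of_baseChange_mem_innerAut (hG.inner_Ad g)

theorem IsSemisimpleHC.one_le_norm_lieAd [Nontrivial E] (hG : IsSemisimpleHC E G) (g : G) :
    1 ≤ ‖lieAd E g‖ :=
  ContinuousLinearMap.one_le_norm_of_det_eq_one (hG.det_lieAd g)

/-- The sign of `log ‖Ad g‖` gives the lower bound needed for integrability. For `E = 0` the operator
norm is `0`, and `Real.log 0 = 0`. -/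
theorem IsSemisimpleHC.log_norm_lieAd_nonneg (hG : IsSemisimpleHC E G) (g : G) :
    0 ≤ Real.log ‖lieAd E g‖ := by
  rcases subsingleton_or_nontrivial E with hE | hE
  · rw [Subsingleton.elim (lieAd E g) 0]
    simp
  · exact Real.log_nonneg (hG.one_le_norm_lieAd g)

theorem IsSemisimpleHC.log_norm_lieAd_mul_le (hG : IsSemisimpleHC E G) (g h : G) :
    Real.log ‖lieAd E (g * h)‖ ≤ Real.log ‖lieAd E g‖ + Real.log ‖lieAd E h‖ := by
  rcases subsingleton_or_nontrivial E with hE | hE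
  · rw [Subsingleton.elim (lieAd E (g * h)) 0, norm_zero, Real.log_zero]
    exact add_nonneg (hG.log_norm_lieAd_nonneg g) (hG.log_norm_lieAd_nonneg h)
  · have hpos : ∀ k : G, 0 < ‖lieAd E k‖ := fun k => one_pos.trans_le (hG.one_le_norm_lieAd k)
    rw [← Real.log_mul (hpos g).ne' (hpos h).ne', lieAd_mul]
    refine Real.log_le_log ?_ (ContinuousLinearMap.opNorm_comp_le _ _)
    rw [← lieAd_mul]
    exact hpos _

end LogNormAd

theorem CartanData.smul_mem_chamber {E : Type*} [NormedAddCommGroup E] [NormedSpace ℝ E]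
    [CompleteSpace E] {G : Type*} [TopologicalSpace G] [ChartedSpace E G] [Group G]
    [LieGroup 𝓘(ℝ, E) (minSmoothness ℝ 3) G] (D : CartanData E G) {c : ℝ} (hc : 0 ≤ c) {x : D.𝔞}
    (hx : x ∈ D.chamber) : c • x ∈ D.chamber := fun α hα => by
  rw [map_smul, smul_eq_mul]
  exact mul_nonneg hc (hx α hα)

/-- Cocycles over the induced system are sampled at the return times, which grow at the rate
`1 / m(Y)`. -/
theorem Ergodic.ae_tendsto_cocycle_inducedF {X : Type*} [MeasurableSpace X] {m : Measure X}
    [IsProbabilityMeasure m] {T : X → X} (hT : Ergodic T m) {Y : Set X} (hY : MeasurableSet Y)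
    (hmY : 0 < m Y) {G : Type*} [Group G] {F : X → G} {V : Type*} [AddCommGroup V] [Module ℝ V]
    [TopologicalSpace V] [ContinuousSMul ℝ V] {κ : G → V} {v : V}
    (h : ∀ᵐ x ∂m, Tendsto (fun n : ℕ => (n : ℝ)⁻¹ • κ (cocycle T F n x)) atTop (𝓝 v)) :
    ∀ᵐ y ∂(inducedMeasure Y m),
      Tendsto (fun n : ℕ => (n : ℝ)⁻¹ • κ (cocycle (inducedMap T Y) (inducedF T Y F) n y))
        atTop (𝓝 ((1 / m.real Y) • v)) := by
  have hb := hT.ae_tendsto_birkhoffAverage (f := Y.indicator 1)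
    (measurable_one.indicator hY) ((integrable_const (1 : ℝ)).indicator hY)
  rw [integral_indicator_one hY] at hb
  filter_upwards [ae_inducedMeasure_of_ae hY hb, ae_inducedMeasure_of_ae hY h,
    ae_inducedMeasure_of_ae hY (hT.ae_frequently_iterate_mem hY hmY)] with y h1 h2 h3
  simp only [cocycle_inducedF]
  have hc : m.real Y ≠ 0 := (ENNReal.toReal_pos hmY.ne' (measure_ne_top m Y)).ne'
  exact tendsto_comp_kthReturnTime h3 hc h1 h2

theorem proposition2p3
    {E : Type*} [NormedAddCommGroup E] [NormedSpace ℝ E] [FiniteDimensional ℝ E] [CompleteSpace E]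
    {G : Type*} [TopologicalSpace G] [ChartedSpace E G] [Group G]
    [LieGroup 𝓘(ℝ, E) (minSmoothness ℝ 3) G] [SecondCountableTopology G]
    [MeasurableSpace G] [BorelSpace G]
    (hG : IsSemisimpleHC E G) (D : CartanData E G)
    {X : Type*} [MeasurableSpace X] (m : Measure X) [IsProbabilityMeasure m]
    (T : X → X) (hT : Ergodic T m) (F : X → G) (hF : Measurable F)
    (Y : Set X) (hY : MeasurableSet Y) (hmY : 0 < m Y)
    (Λ : D.𝔞) (hΛ : IsLyapunovSpectrum D m T F Λ) :
    (∀ Λ' : D.𝔞,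
      IsLyapunovSpectrum D (inducedMeasure Y m) (inducedMap T Y) (inducedF T Y F) Λ' ↔
        Λ' = (1 / m.real Y) • Λ) ∧
    Integrable (fun y : Y => (returnTime T Y y : ℝ)) (inducedMeasure Y m) ∧
    ∫ y : Y, (returnTime T Y y : ℝ) ∂(inducedMeasure Y m) = 1 / m.real Y := by

  have := isProbabilityMeasure_inducedMeasure hY hmY
  have := topologicalGroup_of_lieGroup 𝓘(ℝ, E) (minSmoothness ℝ 3) (G := G)
  have : ContinuousSMul ℝ (LieAlg E G) := inferInstanceAs (ContinuousSMul ℝ E)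
  have : T2Space (LieAlg E G) := inferInstanceAs (T2Space E)
  have hlim := hT.ae_tendsto_cocycle_inducedF hY hmY hΛ.tendsto
  refine ⟨fun Λ' => ⟨fun h => ?_, ?_⟩, hT.integrable_returnTime hY hmY,
    hT.integral_returnTime hY hmY⟩
  · obtain ⟨y, h1, h2⟩ := (h.tendsto.and hlim).exists
    exact tendsto_nhds_unique h1 h2
  · rintro rfl
    refine ⟨?_, D.smul_mem_chamber (by positivity) hΛ.mem_chamber, hlim⟩
    exact hT.integrable_inducedMeasure_of_le hY hmY (measurable_log_norm_lieAd.comp hF)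
      hΛ.integrable (fun x => hG.log_norm_lieAd_nonneg _)
      (measurable_log_norm_lieAd.comp (measurable_inducedF hT.measurable hF hY))
      (fun y => hG.log_norm_lieAd_nonneg _)
      fun y => map_cocycle_le_sum (ℓ := fun g : G => Real.log ‖lieAd E g‖)
        log_norm_lieAd_one_nonpos hG.log_norm_lieAd_mul_le _ _
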